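/- Let $V$ be a Euclidean space of finite dimension $m$ with orthonormal basis $b_1,\dots,b_m$; write $x_i=\langle b_i,x\rangle$ and let $\partial_i$ be the partial derivative along $b_i$. Let $R\subset V\setminus\{0\}$ be a finite root system, i.e. $\sigma_\alpha(R)=R$ for all $\alpha\in R$, where $\sigma_\alpha(x)=x-2\frac{\langle\alpha,x\rangle}{\langle\alpha,\alpha\rangle}\alpha$. Let $R_+$ be the positive subsystem determined by a simple system $S$, let $W$ be the (finite) group generated by the reflections $\sigma_\alpha$, $\alpha\in R$, and let $k:R\to[0,\infty)$ be constant on the $W$-orbits. For $\xi\in V$ let $T_\xi$ be the Dunkl operator $$T_\xi f(x)=\partial_\xi f(x)+\sum_{\alpha\in R_+}k(\alpha)\langle\alpha,\xi\rangle\frac{f(x)-f(\sigma_\alpha x)}{\langle\alpha,x\rangle},$$ where on the hyperplane $\langle\alpha,x\rangle=0$ the quotient is replaced by its limit $\frac{2}{\langle\alpha,\alpha\rangle}\partial_\alpha f(x)$. Put $T_i=T_{b_i}$, $\Delta_k=\sum_{i=1}^m T_i^2$ (the Dunkl Laplacian), $E_1=\sum_{i=1}^m x_i\partial_i$ (the Euler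 operator) and $\mathscr{J}_k=-\Delta_k+E_1$; a superscript $x$ or $y$ indicates the variable on which an operator acts. For every $y\in V$ there is exactly one real-analytic function $x\mapsto D_k(x,y)$ on $V$ with $D_k(0,y)=1$ and $T_\xi^x D_k(x,y)=\langle\xi,y\rangle D_k(x,y)$ for all $\xi\in V$ (the Dunkl kernel). The generalized Bessel function $D_k^W(x,y)=\sum_{w\in W}D_k(x,wy)$ is $C^\infty$ on $V\times V$, and for all $x,y\in V$ $$\mathscr{J}_k^x\big[e^{-|y|^2/2}D_k^W(x,y)\big]=E_1^y\big[e^{-|y|^2/2}D_k^W(x,y)\big].$$ -/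

import Mathlib

open scoped ContDiff

noncomputable section

/-- The orthogonal reflection in the hyperplane orthogonal to `α`,
`x ↦ x - 2 (⟪α, x⟫ / ⟪α, α⟫) α` for `α ≠ 0`. -/
def rootReflection {V : Type*} [NormedAddCommGroup V] [InnerProductSpace ℝ V]
    (α : V) : V ≃ₗᵢ[ℝ] V :=
  (ℝ ∙ α)ᗮ.reflection

theorem rootReflection_apply {V : Type*} [NormedAddCommGroup V] [InnerProductSpace ℝ V]
    (α x : V) :
    rootReflection α x = x - (2 * (inner ℝ α x / inner ℝ α α)) • α := by
  rw [rootReflection, Submodule.reflection_orthogonal_apply,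
    Submodule.reflection_singleton_apply, real_inner_self_eq_norm_sq]
  simp only [RCLike.ofReal_real_eq_id, id_eq, neg_sub, two_smul, two_mul, add_smul]

/-- A (finite) root system in a Euclidean space: nonzero vectors, with `σ_α (R) = R` for every
root `α`.  It need not span, need not be reduced and need not be crystallographic. -/
structure EuclideanRootSystem (V : Type*) [NormedAddCommGroup V] [InnerProductSpace ℝ V] where
  roots : Finset V
  ne_zero : ∀ α ∈ roots, α ≠ 0
  image_reflection : ∀ α ∈ roots, rootReflection α '' (roots : Set V) = (roots : Set V)

namespace EuclideanRootSystem

/-- `v` is a linear combination of elements of `S` with nonnegative coefficients. -/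
def IsNonnegComb {V : Type*} [NormedAddCommGroup V] [InnerProductSpace ℝ V]
    (S : Finset V) (v : V) : Prop :=
  ∃ c : V → ℝ, (∀ s ∈ S, 0 ≤ c s) ∧ v = ∑ s ∈ S, c s • s

/-- A simple system: roots forming a basis of the span of the root system, such that every root
is a combination of them with coefficients of one sign. -/
structure SimpleSystem {V : Type*} [NormedAddCommGroup V] [InnerProductSpace ℝ V]
    (Φ : EuclideanRootSystem V) where
  simple : Finset V
  subset_roots : simple ⊆ Φ.roots
  linearIndependent : LinearIndepOn ℝ id (simple : Set V)
  span_eq : Submodule.span ℝ (simple : Set V) = Submodule.span ℝ (Φ.roots : Set V)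
  nonneg_or_nonpos : ∀ α ∈ Φ.roots, IsNonnegComb simple α ∨ IsNonnegComb simple (-α)

open Classical in
/-- The positive subsystem `R₊` attached to a simple system. -/
def SimpleSystem.positiveRoots {V : Type*} [NormedAddCommGroup V] [InnerProductSpace ℝ V]
    {Φ : EuclideanRootSystem V} (S : Φ.SimpleSystem) : Finset V :=
  Φ.roots.filter (fun α => IsNonnegComb S.simple α)

/-- The reflection group `W`, generated by the reflections `σ_α`, `α ∈ R`. -/
def weylGroup {V : Type*} [NormedAddCommGroup V] [InnerProductSpace ℝ V]
    (Φ : EuclideanRootSystem V) : Subgroup (V ≃ₗᵢ[ℝ] V) :=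
  Subgroup.closure (rootReflection '' (Φ.roots : Set V))

theorem weylGroup_map_roots {V : Type*} [NormedAddCommGroup V] [InnerProductSpace ℝ V]
    (Φ : EuclideanRootSystem V) {w : V ≃ₗᵢ[ℝ] V} (hw : w ∈ Φ.weylGroup) :
    w '' (Φ.roots : Set V) = (Φ.roots : Set V) := by
  induction hw using Subgroup.closure_induction with
  | mem w hw =>
    obtain ⟨α, hα, rfl⟩ := hw
    exact Φ.image_reflection α hα
  | one => simp
  | mul u v _ _ hu hv =>
    rw [LinearIsometryEquiv.coe_mul, Set.image_comp, hv, hu]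
  | inv u _ hu =>
    conv_lhs => rw [← hu]
    rw [← Set.image_comp, ← LinearIsometryEquiv.coe_mul]
    simp

theorem weylGroup_fix_orthogonal {V : Type*} [NormedAddCommGroup V] [InnerProductSpace ℝ V]
    (Φ : EuclideanRootSystem V) {w : V ≃ₗᵢ[ℝ] V} (hw : w ∈ Φ.weylGroup)
    {v : V} (hv : v ∈ (Submodule.span ℝ (Φ.roots : Set V))ᗮ) : w v = v := by
  induction hw using Subgroup.closure_induction with
  | mem w hw =>
    obtain ⟨α, hα, rfl⟩ := hw
    rw [rootReflection_apply,
      (Submodule.mem_orthogonal _ v).1 hv α (Submodule.subset_span hα)]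
    simp
  | one => rfl
  | mul a b _ _ ha hb =>
    rw [LinearIsometryEquiv.coe_mul, Function.comp_apply, hb, ha]
  | inv a _ ha =>
    conv_lhs => rw [← ha]
    exact a.symm_apply_apply v

/-- The reflection group of a finite root system is finite. -/
instance finite_weylGroup {V : Type*} [NormedAddCommGroup V] [InnerProductSpace ℝ V]
    (Φ : EuclideanRootSystem V) : Finite Φ.weylGroup := by
  let F : Φ.weylGroup → (Φ.roots → Φ.roots) := fun w α =>
    ⟨(w : V ≃ₗᵢ[ℝ] V) α, by
      have h : (w : V ≃ₗᵢ[ℝ] V) α ∈ (w : V ≃ₗᵢ[ℝ] V) '' (Φ.roots : Set V) :=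
        Set.mem_image_of_mem _ α.2
      rw [Φ.weylGroup_map_roots w.2] at h
      exact h⟩
  refine Finite.of_injective F ?_
  intro u w huw
  apply Subtype.ext
  apply LinearIsometryEquiv.ext
  intro x
  have hroots : ∀ α ∈ Φ.roots, (u : V ≃ₗᵢ[ℝ] V) α = (w : V ≃ₗᵢ[ℝ] V) α := fun α hα =>
    congrArg Subtype.val (congrFun huw ⟨α, hα⟩)
  have hfin : FiniteDimensional ℝ (Submodule.span ℝ (Φ.roots : Set V)) :=
    FiniteDimensional.span_finset ℝ Φ.roots
  obtain ⟨p, hp, q, hq, rfl⟩ :=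
    (Submodule.span ℝ (Φ.roots : Set V)).exists_add_mem_mem_orthogonal (v := x)
  rw [map_add, map_add, Φ.weylGroup_fix_orthogonal u.2 hq, Φ.weylGroup_fix_orthogonal w.2 hq]
  congr 1
  induction hp using Submodule.span_induction with
  | mem a ha => exact hroots a ha
  | zero => simp
  | add a b _ _ ha hb => rw [map_add, map_add, ha, hb]
  | smul c a _ ha => rw [map_smul, map_smul, ha]

instance fintype_weylGroup {V : Type*} [NormedAddCommGroup V] [InnerProductSpace ℝ V]
    (Φ : EuclideanRootSystem V) : Fintype Φ.weylGroup :=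
  Fintype.ofFinite _

/-- A nonnegative multiplicity function: constant on each `W`-orbit of roots. Only the values at
roots matter. -/
structure Multiplicity {V : Type*} [NormedAddCommGroup V] [InnerProductSpace ℝ V]
    (Φ : EuclideanRootSystem V) where
  toFun : V → ℝ
  nonneg : ∀ α ∈ Φ.roots, 0 ≤ toFun α
  invariant : ∀ w ∈ Φ.weylGroup, ∀ α ∈ Φ.roots, toFun (w α) = toFun α

end EuclideanRootSystem

open EuclideanRootSystem

open Classical in
/-- The difference quotient `(f x - f (σ_α x)) / ⟪α, x⟫`, extended to the hyperplane
`⟪α, x⟫ = 0` by its limit there, the derivative of `f` along `2 α / ⟪α, α⟫`. -/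
def dunklQuotient {V : Type*} [NormedAddCommGroup V] [InnerProductSpace ℝ V]
    (α : V) (f : V → ℝ) (x : V) : ℝ :=
  if inner ℝ α x = 0 then fderiv ℝ f x ((2 / inner ℝ α α : ℝ) • α)
  else (f x - f (rootReflection α x)) / inner ℝ α x

/-- The Dunkl operator `T_ξ` in the direction `ξ`. -/
def dunklOp {V : Type*} [NormedAddCommGroup V] [InnerProductSpace ℝ V]
    {Φ : EuclideanRootSystem V} (S : Φ.SimpleSystem) (k : Φ.Multiplicity)
    (ξ : V) (f : V → ℝ) (x : V) : ℝ :=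
  fderiv ℝ f x ξ + ∑ α ∈ S.positiveRoots, k.toFun α * inner ℝ α ξ * dunklQuotient α f x

/-- `f` is a real-analytic solution on all of `V` of the joint eigenvalue problem
`T_ξ f = ⟪ξ, y⟫ f` for all `ξ`, `f 0 = 1`. -/
structure IsDunklEigenfunction {V : Type*} [NormedAddCommGroup V] [InnerProductSpace ℝ V]
    {Φ : EuclideanRootSystem V} (S : Φ.SimpleSystem) (k : Φ.Multiplicity)
    (y : V) (f : V → ℝ) : Prop where
  analytic : AnalyticOnNhd ℝ f Set.univ
  eigen : ∀ ξ x : V, dunklOp S k ξ f x = inner ℝ ξ y * f x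
  map_zero : f 0 = 1

/-- The Dunkl kernel `D_k (x, y)`: as a function of `x`, the real-analytic solution of
`T_ξ f = ⟪ξ, y⟫ f`, `f 0 = 1`. -/
def dunklKernel {V : Type*} [NormedAddCommGroup V] [InnerProductSpace ℝ V]
    {Φ : EuclideanRootSystem V} (S : Φ.SimpleSystem) (k : Φ.Multiplicity) (x y : V) : ℝ :=
  Classical.epsilon (IsDunklEigenfunction S k y) x

/-- The generalized Bessel function `D_k^W (x, y) = ∑_{w ∈ W} D_k (x, w y)`. -/
def generalizedBessel {V : Type*} [NormedAddCommGroup V] [InnerProductSpace ℝ V]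
    {Φ : EuclideanRootSystem V} (S : Φ.SimpleSystem) (k : Φ.Multiplicity) (x y : V) : ℝ :=
  ∑ w : Φ.weylGroup, dunklKernel S k x ((w : V ≃ₗᵢ[ℝ] V) y)

/-- The Dunkl Laplacian `Δ_k = ∑ᵢ Tᵢ²`, where `Tᵢ = T_{bᵢ}`. -/
def dunklLaplacian {V : Type*} [NormedAddCommGroup V] [InnerProductSpace ℝ V] {m : ℕ}
    (b : OrthonormalBasis (Fin m) ℝ V)
    {Φ : EuclideanRootSystem V} (S : Φ.SimpleSystem) (k : Φ.Multiplicity)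
    (f : V → ℝ) (x : V) : ℝ :=
  ∑ i, dunklOp S k (b i) (dunklOp S k (b i) f) x

/-- The Euler operator `E₁ = ∑ᵢ xᵢ ∂ᵢ`. -/
def eulerOp {V : Type*} [NormedAddCommGroup V] [InnerProductSpace ℝ V] {m : ℕ}
    (b : OrthonormalBasis (Fin m) ℝ V) (f : V → ℝ) (x : V) : ℝ :=
  ∑ i, b.repr x i * fderiv ℝ f x (b i)

/-- The operator `J_k = -Δ_k + E₁`. -/
def dunklJ {V : Type*} [NormedAddCommGroup V] [InnerProductSpace ℝ V] {m : ℕ}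
    (b : OrthonormalBasis (Fin m) ℝ V)
    {Φ : EuclideanRootSystem V} (S : Φ.SimpleSystem) (k : Φ.Multiplicity)
    (f : V → ℝ) (x : V) : ℝ :=
  -dunklLaplacian b S k f x + eulerOp b f x

end

/-! For fixed `y`, contracting `T_ξ f = ⟪ξ, y⟫ f` with `ξ = x` clears the denominators and leaves
the radial equation `IsRadialSolution`: the Euler derivative plus `∑ k(α) (f x - f (σ_α x))` equals
`⟪x, y⟫ f x`. This one equation with `f 0 = 1` already determines the kernel.

Uniqueness: along the rays through a `W`-orbit the radial equation is a linear system with a regular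
singularity at `t = 0`. Since `k ≥ 0`, its exchange part is dissipative, and an energy estimate
(`eq_zero_of_singular_exchange_system`) kills solutions vanishing at `0`.

Existence: the equation is lifted to `ℝ^W` and solved by an entire power series `F`
(`exists_entire_solution`); then `K x y = F ((⟪y, w x⟫)_w)` is jointly smooth and satisfies `K (t x)
y = K x (t y)`. A radial solution solves the full problem because the defects `T_ξ f - ⟪ξ, y⟫ f`
obey a system of the same singular type (`IsRadialSolution.hasDerivAt_defect`), hence vanish at
regular points, and everywhere by density. Commutativity of the `T_ξ` is not needed.

The identity follows: `Δ_k` multiplies each `D_k(·, w y)` by `|w y|² = |y|²`, the scaling symmetry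
gives `E₁^x = E₁^y` on `D_k^W`, and `E₁^y` of the Gaussian supplies the matching `-|y|²`. -/

/-! ### Power series solution of the lifted radial equation. -/

theorem exists_resolvent_solution {Y : Type*} [NormedAddCommGroup Y] [NormedSpace ℝ Y]
    [CompleteSpace Y] (A : Y →L[ℝ] Y) {γ s : ℝ} (hA : ‖A‖ ≤ γ) (hs : 0 < s) (r : Y) :
    ∃ q : Y, (s + γ) • q - A q = r ∧ s * ‖q‖ ≤ ‖r‖ := by
  have hγ : 0 ≤ γ := (norm_nonneg A).trans hA
  have hpos : 0 < s + γ := by linarith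
  have hlt : ‖(s + γ)⁻¹ • A‖ < 1 := by
    rw [norm_smul, norm_inv, Real.norm_of_nonneg hpos.le, inv_mul_lt_iff₀ hpos]
    linarith
  obtain ⟨u, hu⟩ := isUnit_one_sub_of_norm_lt_one hlt
  have key : (s + γ) • ((s + γ)⁻¹ • (↑u⁻¹ : Y →L[ℝ] Y) r) -
      A ((s + γ)⁻¹ • (↑u⁻¹ : Y →L[ℝ] Y) r) = r := by
    have h : (↑u : Y →L[ℝ] Y) ((↑u⁻¹ : Y →L[ℝ] Y) r) = r := by
      exact DFunLike.congr_fun u.mul_inv r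
    rw [hu] at h
    rw [smul_inv_smul₀ hpos.ne', map_smul]
    exact h
  refine ⟨(s + γ)⁻¹ • (↑u⁻¹ : Y →L[ℝ] Y) r, key, ?_⟩
  set q := (s + γ)⁻¹ • (↑u⁻¹ : Y →L[ℝ] Y) r
  have h1 : ‖(s + γ) • q‖ ≤ ‖r‖ + γ * ‖q‖ := by
    calc ‖(s + γ) • q‖ = ‖r + A q‖ := by rw [← key]; congr 1; abel
      _ ≤ ‖r‖ + ‖A q‖ := norm_add_le _ _
      _ ≤ ‖r‖ + γ * ‖q‖ := by gcongr; exact A.le_of_opNorm_le hA q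
  rw [norm_smul, Real.norm_of_nonneg hpos.le] at h1
  linarith

/-- With `γ = ∑ c i` and `A = ∑ c i • B i` the operator is `(s + γ) - A` with `‖A‖ ≤ γ`, so a
Neumann series inverts it. The bound `1 / s` on the inverse does not involve `c`. -/
theorem exists_averaging_solution {Y ι : Type*} [NormedAddCommGroup Y] [NormedSpace ℝ Y]
    [CompleteSpace Y] (I : Finset ι) (c : ι → ℝ) (hc : ∀ i ∈ I, 0 ≤ c i) (B : ι → Y →L[ℝ] Y)
    (hB : ∀ i ∈ I, ‖B i‖ ≤ 1) {s : ℝ} (hs : 0 < s) (r : Y) :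
    ∃ q : Y, s • q + ∑ i ∈ I, c i • (q - B i q) = r ∧ s * ‖q‖ ≤ ‖r‖ := by
  have hA : ‖∑ i ∈ I, c i • B i‖ ≤ ∑ i ∈ I, c i := by
    refine (norm_sum_le _ _).trans (Finset.sum_le_sum fun i hi => ?_)
    rw [norm_smul, Real.norm_of_nonneg (hc i hi)]
    exact mul_le_of_le_one_right (hc i hi) (hB i hi)
  obtain ⟨q, hq, hle⟩ := exists_resolvent_solution _ hA hs r
  refine ⟨q, ?_, hle⟩
  rw [← hq, sum_apply, add_smul, Finset.sum_smul, add_sub_assoc, ← Finset.sum_sub_distrib]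
  simp only [smul_sub, smul_apply]

/-- Passage from the part of degree `n` to that of degree `n + 1`: the Euler derivative acts on the
latter as `n + 1`, which plays the role of `s`. The multilinear maps need not be symmetric; the
equation is used on the diagonal only. -/
theorem exists_homogeneous_solution {Z ι : Type*} [NormedAddCommGroup Z] [NormedSpace ℝ Z]
    (I : Finset ι) (c : ι → ℝ) (hc : ∀ i ∈ I, 0 ≤ c i) (τ : ι → Z →L[ℝ] Z)
    (hτ : ∀ i ∈ I, ‖τ i‖ ≤ 1) (φ : Z →L[ℝ] ℝ) (n : ℕ) (P : Z [×n]→L[ℝ] ℝ) :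
    ∃ Q : Z [×(n + 1)]→L[ℝ] ℝ, (n + 1) * ‖Q‖ ≤ ‖φ‖ * ‖P‖ ∧
      ∀ z, (n + 1) * Q (fun _ => z) + ∑ i ∈ I, c i * (Q (fun _ => z) - Q (fun _ => τ i z)) =
        φ z * P (fun _ => z) := by
  obtain ⟨Q, hQ, hle⟩ := exists_averaging_solution I c hc
    (fun i => ContinuousMultilinearMap.compContinuousLinearMapL (F := ℝ)
      (fun _ : Fin (n + 1) => τ i))
    (fun i hi => (ContinuousMultilinearMap.norm_compContinuousLinearMapL_le (𝕜 := ℝ)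
      (E := fun _ : Fin (n + 1) => Z) (E₁ := fun _ => Z) ℝ fun _ => τ i).trans
        (Finset.prod_le_one (fun _ _ => norm_nonneg _) fun _ _ => hτ i hi))
    (s := (n : ℝ) + 1) (by positivity)
    (ContinuousLinearMap.uncurryLeft (Ei := fun _ : Fin (n + 1) => Z) (φ.smulRight P))
  refine ⟨Q, ?_, fun z => ?_⟩
  · refine hle.trans_eq ?_
    exact (ContinuousLinearMap.uncurryLeft_norm _).trans
      (ContinuousLinearMap.norm_smulRight_apply _ _)
  · have h := DFunLike.congr_fun hQ (fun _ => z)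
    rw [add_apply, sum_apply] at h
    exact h

/-- An entire solution of the Euler-type equation
`DF(z) z + ∑ cᵢ (F z - F (τᵢ z)) = φ z * F z`, obtained by solving for its homogeneous parts. -/
theorem exists_entire_solution {Z ι : Type*} [NormedAddCommGroup Z] [NormedSpace ℝ Z]
    (I : Finset ι) (c : ι → ℝ) (hc : ∀ i ∈ I, 0 ≤ c i) (τ : ι → Z →L[ℝ] Z)
    (hτ : ∀ i ∈ I, ‖τ i‖ ≤ 1) (φ : Z →L[ℝ] ℝ) :
    ∃ F : Z → ℝ, AnalyticOnNhd ℝ F Set.univ ∧ F 0 = 1 ∧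
      ∀ z, fderiv ℝ F z z + ∑ i ∈ I, c i * (F z - F (τ i z)) = φ z * F z := by
  choose L hLn hLe using exists_homogeneous_solution I c hc τ hτ φ
  let p : FormalMultilinearSeries ℝ Z ℝ := fun n =>
    Nat.rec (ContinuousMultilinearMap.constOfIsEmpty ℝ (fun _ : Fin 0 => Z) (1 : ℝ))
      (fun n P => L n P) n
  -- Each degree gains a factor `‖φ‖ / (n + 1)`, whence exponential-type decay and infinite radius.
  have hnorm : ∀ n, ‖p n‖ ≤ ‖φ‖ ^ n / n.factorial := by
    intro n
    induction n with
    | zero => simp [p]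
    | succ n ih =>
      have h : ((n : ℝ) + 1) * ‖p (n + 1)‖ ≤ ‖φ‖ * ‖p n‖ := hLn n (p n)
      have hn : (0 : ℝ) < n + 1 := by positivity
      rw [Nat.factorial_succ, Nat.cast_mul, Nat.cast_succ, mul_comm, ← div_div, le_div_iff₀ hn,
        mul_comm]
      refine h.trans ?_
      rw [pow_succ', mul_div_assoc]
      gcongr
  have hrad : p.radius = ⊤ := by
    refine p.radius_eq_top_of_summable_norm fun r => ?_
    refine Summable.of_nonneg_of_le (fun n => by positivity) (fun n => ?_)
      (Real.summable_pow_div_factorial (‖φ‖ * r))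
    rw [mul_pow, mul_div_right_comm]
    gcongr
    exact hnorm n
  have hp : HasFPowerSeriesOnBall p.sum p 0 ⊤ := by
    have := p.hasFPowerSeriesOnBall (by simp [hrad])
    rwa [hrad] at this
  have hsum : ∀ z, HasSum (fun n => p n fun _ => z) (p.sum z) := fun z => by
    simpa using hp.hasSum (y := z) (by simp)
  refine ⟨p.sum, by simpa using hp.analyticOnNhd, ?_, fun z => ?_⟩
  · rw [← hp.coeff_zero (fun _ => 0)]
    rfl
  · have hder : HasSum (fun n : ℕ => ((n : ℝ) + 1) * p (n + 1) fun _ => z)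
        (fderiv ℝ p.sum z z) := by
      have h := (hp.fderiv.hasSum (y := z) (by simp)).mapL (ContinuousLinearMap.apply ℝ ℝ z)
      simp only [zero_add, ContinuousLinearMap.apply_apply,
        FormalMultilinearSeries.derivSeries_apply_diag] at h
      simpa using h
    have hdiff : ∀ i ∈ I, HasSum
        (fun n : ℕ => c i * ((p (n + 1) fun _ => z) - p (n + 1) fun _ => τ i z))
        (c i * (p.sum z - p.sum (τ i z))) := fun i _ => by
      -- The constant terms cancel in the difference, so the index may be shifted to match the
      -- derivative series.
      have h := (hasSum_nat_add_iff' 1).2 ((hsum z).sub (hsum (τ i z)))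
      have h0 : ∀ u v : Z, (p 0 fun _ => u) = p 0 fun _ => v := fun _ _ => rfl
      simp only [Finset.sum_range_one, h0 z (τ i z), sub_self, sub_zero] at h
      exact h.mul_left (c i)
    have h1 := hder.add (hasSum_sum (s := I) hdiff)
    have h2 := (hsum z).mul_left (φ z)
    rw [show (fun n => φ z * p n fun _ => z) = _ from funext fun n => (hLe n (p n) z).symm] at h2
    exact h1.unique h2

/-! ### Uniqueness for singular exchange systems. -/

/-- Energy method: permutations preserve `∑ H_w²`, so by `2ab ≤ a² + b²` the exchange terms,
singular at `t = 0`, cannot increase it. Only the bounded part `a` contributes growth, and the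
factor `exp (-2Ct)` absorbs that. -/
theorem eq_zero_of_singular_exchange_system {W ι : Type*} [Fintype W] (I : Finset ι) (c : ι → ℝ)
    (hc : ∀ i ∈ I, 0 ≤ c i) (e : ι → Equiv.Perm W) (a : W → ℝ) (H d : W → ℝ → ℝ)
    (hcont : ∀ w, ContinuousOn (H w) (Set.Icc 0 1)) (hzero : ∀ w, H w 0 = 0)
    (hderiv : ∀ w, ∀ t ∈ Set.Ioo (0 : ℝ) 1, HasDerivAt (H w) (d w t) t)
    (heq : ∀ w, ∀ t ∈ Set.Ioo (0 : ℝ) 1,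
      t * d w t = ∑ i ∈ I, c i * (H (e i w) t - H w t) + t * (a w * H w t)) (w : W) :
    H w 1 = 0 := by
  set C : ℝ := ∑ w, |a w| with hC
  let Q : ℝ → ℝ := fun t => (∑ w, H w t ^ 2) * Real.exp (-2 * C * t)
  have hQd : ∀ t ∈ Set.Ioo (0 : ℝ) 1, HasDerivAt Q
      ((∑ w, 2 * H w t * d w t) * Real.exp (-2 * C * t) +
        (∑ w, H w t ^ 2) * (Real.exp (-2 * C * t) * (-2 * C))) t := fun t ht => by
    have h1 : HasDerivAt (fun t => ∑ w, H w t ^ 2) (∑ w, 2 * H w t * d w t) t := by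
      refine HasDerivAt.fun_sum fun w _ => ?_
      simpa using (hderiv w t ht).fun_pow 2
    have h2 : HasDerivAt (fun t => Real.exp (-2 * C * t)) (Real.exp (-2 * C * t) * (-2 * C)) t := by
      simpa using ((hasDerivAt_id t).const_mul (-2 * C)).exp
    exact h1.mul h2
  have hle : ∀ t ∈ Set.Ioo (0 : ℝ) 1, ∑ w, H w t * d w t ≤ C * ∑ w, H w t ^ 2 := fun t ht => by
    refine le_of_mul_le_mul_left ?_ ht.1
    have hswap : ∀ i ∈ I, ∑ w, H w t * (H (e i w) t - H w t) ≤ 0 := fun i _ => by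
      calc ∑ w, H w t * (H (e i w) t - H w t) ≤ ∑ w, (H (e i w) t ^ 2 - H w t ^ 2) / 2 :=
            Finset.sum_le_sum fun w _ => by nlinarith [sq_nonneg (H (e i w) t - H w t)]
        _ = 0 := by
            rw [← Finset.sum_div, Finset.sum_sub_distrib,
              Equiv.sum_comp (e i) fun w => H w t ^ 2, sub_self, zero_div]
    calc t * ∑ w, H w t * d w t
        = ∑ w, H w t * ∑ i ∈ I, c i * (H (e i w) t - H w t) + t * ∑ w, a w * H w t ^ 2 := by
          rw [Finset.mul_sum, Finset.mul_sum, ← Finset.sum_add_distrib]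
          refine Finset.sum_congr rfl fun w _ => ?_
          linear_combination H w t * heq w t ht
      _ = ∑ i ∈ I, c i * ∑ w, H w t * (H (e i w) t - H w t) + t * ∑ w, a w * H w t ^ 2 := by
          congr 1
          simp only [Finset.mul_sum]
          rw [Finset.sum_comm]
          exact Finset.sum_congr rfl fun _ _ => Finset.sum_congr rfl fun _ _ => by ring
      _ ≤ 0 + t * (C * ∑ w, H w t ^ 2) := by
          gcongr
          · exact Finset.sum_nonpos fun i hi =>
              mul_nonpos_of_nonneg_of_nonpos (hc i hi) (hswap i hi)
          · exact ht.1.le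
          · rw [Finset.mul_sum]
            refine Finset.sum_le_sum fun w _ => ?_
            gcongr
            exact (le_abs_self _).trans
              (Finset.single_le_sum (fun w _ => abs_nonneg (a w)) (Finset.mem_univ w))
      _ = t * (C * ∑ w, H w t ^ 2) := zero_add _
  have hanti : AntitoneOn Q (Set.Icc 0 1) := by
    refine antitoneOn_of_deriv_nonpos (convex_Icc 0 1) ?_ ?_ ?_
    · exact (continuousOn_finsetSum _ fun w _ => (hcont w).pow 2).mul (by fun_prop)
    · rw [interior_Icc]
      exact fun t ht => (hQd t ht).differentiableAt.differentiableWithinAt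
    · rw [interior_Icc]
      intro t ht
      rw [(hQd t ht).deriv]
      have h1 := hle t ht
      have h2 : ∑ w, 2 * H w t * d w t = 2 * ∑ w, H w t * d w t := by
        rw [Finset.mul_sum]
        exact Finset.sum_congr rfl fun _ _ => by ring
      rw [h2]
      nlinarith [Real.exp_pos (-2 * C * t)]
  have hQ1 : Q 1 ≤ Q 0 := hanti (by simp) (by simp) zero_le_one
  have hQ0 : Q 0 = 0 := by simp [Q, hzero]
  have hs : ∑ w, H w 1 ^ 2 ≤ 0 := by
    rw [hQ0] at hQ1
    exact nonpos_of_mul_nonpos_left hQ1 (Real.exp_pos _)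
  have := (Finset.sum_eq_zero_iff_of_nonneg fun w _ => sq_nonneg (H w 1)).1
    (hs.antisymm (Finset.sum_nonneg fun w _ => sq_nonneg _)) w (Finset.mem_univ w)
  exact pow_eq_zero_iff (two_ne_zero) |>.1 this

/-! ### Reflections and sums over positive roots. -/

section RootSystem

variable {V : Type*} [NormedAddCommGroup V] [InnerProductSpace ℝ V]

theorem rootReflection_apply_eq_sub (α x : V) :
    rootReflection α x = x - inner ℝ α x • ((2 / inner ℝ α α : ℝ) • α) := by
  rw [rootReflection_apply, smul_smul]
  congr 2
  ring

theorem rootReflection_self {α : V} (hα : α ≠ 0) : rootReflection α α = -α := by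
  have h : inner ℝ α α ≠ 0 := inner_self_ne_zero.2 hα
  rw [rootReflection_apply, div_self h, mul_one, two_smul]
  abel

theorem rootReflection_neg (α : V) : rootReflection (-α) = rootReflection α := by
  ext x
  rw [rootReflection_apply, rootReflection_apply, inner_neg_neg, inner_neg_left, neg_div, mul_neg,
    neg_smul_neg]

theorem rootReflection_map (w : V ≃ₗᵢ[ℝ] V) (α x : V) :
    rootReflection (w α) (w x) = w (rootReflection α x) := by
  simp only [rootReflection_apply, map_sub, map_smul, w.inner_map_map]

namespace EuclideanRootSystem

variable (Φ : EuclideanRootSystem V)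

theorem rootReflection_mem_weylGroup {α : V} (hα : α ∈ Φ.roots) :
    rootReflection α ∈ Φ.weylGroup :=
  Subgroup.subset_closure (Set.mem_image_of_mem _ hα)

theorem map_mem_roots {w : V ≃ₗᵢ[ℝ] V} (hw : w ∈ Φ.weylGroup) {α : V} (hα : α ∈ Φ.roots) :
    w α ∈ Φ.roots := by
  have h : w α ∈ w '' (Φ.roots : Set V) := Set.mem_image_of_mem w hα
  rwa [Φ.weylGroup_map_roots hw] at h

theorem neg_mem_roots {α : V} (hα : α ∈ Φ.roots) : -α ∈ Φ.roots := by
  rw [← rootReflection_self (Φ.ne_zero α hα)]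
  exact Φ.map_mem_roots (Φ.rootReflection_mem_weylGroup hα) hα

variable {Φ}

theorem Multiplicity.map_neg (k : Φ.Multiplicity) {α : V} (hα : α ∈ Φ.roots) :
    k.toFun (-α) = k.toFun α := by
  rw [← rootReflection_self (Φ.ne_zero α hα)]
  exact k.invariant _ (Φ.rootReflection_mem_weylGroup hα) α hα

namespace SimpleSystem

variable (S : Φ.SimpleSystem)

theorem mem_roots_of_mem_positiveRoots {α : V} (hα : α ∈ S.positiveRoots) : α ∈ Φ.roots := by
  classical
  exact (Finset.mem_filter.1 hα).1

theorem not_isNonnegComb_neg {α : V} (hα : α ∈ S.positiveRoots) :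
    ¬ IsNonnegComb S.simple (-α) := by
  classical
  rintro ⟨d, hd, hd'⟩
  obtain ⟨hr, c, hc, hc'⟩ := Finset.mem_filter.1 hα
  have hsum : ∑ s ∈ S.simple, (c s + d s) • s = 0 := by
    simp only [add_smul, Finset.sum_add_distrib, ← hc', ← hd']
    abel
  have hz := linearIndepOn_finset_iff.1 S.linearIndependent (fun s => c s + d s) hsum
  refine Φ.ne_zero α hr ?_
  rw [hc']
  refine Finset.sum_eq_zero fun s hs => ?_
  have h1 := hz s hs
  have h2 := hc s hs
  have h3 := hd s hs
  rw [show c s = 0 by linarith, zero_smul]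

/-- `R` is the disjoint union of `R₊` and `-R₊`. Sums of even functions thus pass to all of `R`,
which `W` permutes, although `W` does not preserve `R₊`. -/
theorem two_mul_sum_positiveRoots (g : V → ℝ) (hg : ∀ α ∈ Φ.roots, g (-α) = g α) :
    2 * ∑ α ∈ S.positiveRoots, g α = ∑ α ∈ Φ.roots, g α := by
  classical
  have hneg : ∑ α ∈ Φ.roots.filter (fun α => ¬ IsNonnegComb S.simple α), g α =
      ∑ α ∈ S.positiveRoots, g α := by
    symm
    refine Finset.sum_nbij' (fun α => -α) (fun α => -α) ?_ ?_ ?_ ?_ ?_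
    · intro α hα
      exact Finset.mem_filter.2 ⟨Φ.neg_mem_roots (S.mem_roots_of_mem_positiveRoots hα),
        S.not_isNonnegComb_neg hα⟩
    · intro α hα
      obtain ⟨hr, hn⟩ := Finset.mem_filter.1 hα
      exact Finset.mem_filter.2 ⟨Φ.neg_mem_roots hr,
        (S.nonneg_or_nonpos α hr).resolve_left hn⟩
    · simp
    · simp
    · intro α hα
      exact (hg α (S.mem_roots_of_mem_positiveRoots hα)).symm
  rw [← Finset.sum_filter_add_sum_filter_not Φ.roots (fun α => IsNonnegComb S.simple α), hneg,
    two_mul]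
  rfl

theorem sum_positiveRoots_map {w : V ≃ₗᵢ[ℝ] V} (hw : w ∈ Φ.weylGroup) (g : V → ℝ)
    (hg : ∀ α ∈ Φ.roots, g (-α) = g α) :
    ∑ α ∈ S.positiveRoots, g (w α) = ∑ α ∈ S.positiveRoots, g α := by
  have h : 2 * ∑ α ∈ S.positiveRoots, g (w α) = 2 * ∑ α ∈ S.positiveRoots, g α := by
    rw [S.two_mul_sum_positiveRoots g hg, S.two_mul_sum_positiveRoots (fun α => g (w α))]
    · refine Finset.sum_nbij' (fun α => w α) (fun α => w.symm α) ?_ ?_ ?_ ?_ ?_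
      · exact fun α hα => Φ.map_mem_roots hw hα
      · exact fun α hα => Φ.map_mem_roots (inv_mem hw) hα
      · simp
      · simp
      · simp
    · intro α hα
      rw [map_neg, hg _ (Φ.map_mem_roots hw hα)]
  linarith

end SimpleSystem

end EuclideanRootSystem

end RootSystem

/-! ### Continuity, equivariance and linearity of Dunkl operators. -/

section DunklOperator

variable {V : Type*} [NormedAddCommGroup V] [InnerProductSpace ℝ V]

theorem dunklQuotient_of_inner_ne_zero {α x : V} (h : inner ℝ α x ≠ 0) (f : V → ℝ) :
    dunklQuotient α f x = (f x - f (rootReflection α x)) / inner ℝ α x := by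
  rw [dunklQuotient, if_neg h]

theorem inner_mul_dunklQuotient (α : V) (f : V → ℝ) (x : V) :
    inner ℝ α x * dunklQuotient α f x = f x - f (rootReflection α x) := by
  by_cases h : inner ℝ α x = 0
  · rw [h, zero_mul, rootReflection_apply_eq_sub, h, zero_smul, sub_zero, sub_self]
  · rw [dunklQuotient_of_inner_ne_zero h, mul_div_cancel₀ _ h]

theorem dunklQuotient_neg (α : V) (f : V → ℝ) (x : V) :
    dunklQuotient (-α) f x = -dunklQuotient α f x := by
  by_cases h : inner ℝ α x = 0
  · rw [dunklQuotient, dunklQuotient, if_pos h, if_pos (by rw [inner_neg_left, h, neg_zero]),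
      inner_neg_neg, smul_neg, map_neg]
  · rw [dunklQuotient_of_inner_ne_zero h,
      dunklQuotient_of_inner_ne_zero (by rwa [inner_neg_left, neg_ne_zero]), rootReflection_neg,
      inner_neg_left, div_neg]

theorem fderiv_comp_linearIsometryEquiv (w : V ≃ₗᵢ[ℝ] V) (f : V → ℝ) (x v : V) :
    fderiv ℝ (fun z => f (w z)) x v = fderiv ℝ f (w x) (w v) := by
  have h := w.toContinuousLinearEquiv.comp_right_fderiv (f := f) (x := x)
  exact DFunLike.congr_fun h v

theorem dunklQuotient_comp (w : V ≃ₗᵢ[ℝ] V) (α : V) (f : V → ℝ) (x : V) :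
    dunklQuotient α (fun z => f (w z)) x = dunklQuotient (w α) f (w x) := by
  simp only [dunklQuotient, w.inner_map_map, fderiv_comp_linearIsometryEquiv, map_smul,
    rootReflection_map]

/-- At a point of the hyperplane, fixed by `σ_α`, strict differentiability compares `f x - f (σ_α
x)` with the derivative along `x - σ_α x = ⟪α, x⟫ v`, with an error `o(⟪α, x⟫)`. -/
theorem continuous_dunklQuotient {α : V} (hα : α ≠ 0) {f : V → ℝ} (hf : ContDiff ℝ 1 f) :
    Continuous (dunklQuotient α f) := by
  set v : V := (2 / inner ℝ α α : ℝ) • α with hv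
  have hvpos : 0 < ‖v‖ := norm_pos_iff.2
    (smul_ne_zero (div_ne_zero two_ne_zero (inner_self_ne_zero.2 hα)) hα)
  have hin : Continuous fun x : V => inner ℝ α x := by fun_prop
  rw [continuous_iff_continuousAt]
  intro x₀
  by_cases h₀ : inner ℝ α x₀ = 0
  · have hfix : rootReflection α x₀ = x₀ := by
      rw [rootReflection_apply_eq_sub, h₀, zero_smul, sub_zero]
    have hst := (hf.contDiffAt (x := x₀)).hasStrictFDerivAt one_ne_zero
    have htend : Filter.Tendsto (fun x => (x, rootReflection α x)) (nhds x₀)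
        (nhds (x₀, x₀)) := by
      have : Continuous fun x => (x, rootReflection α x) := by fun_prop
      simpa [hfix] using this.tendsto x₀
    have hlo := hst.isLittleO.comp_tendsto htend
    have hcont : Continuous fun x => fderiv ℝ f x v :=
      (hf.continuous_fderiv one_ne_zero).clm_apply continuous_const
    rw [ContinuousAt, Metric.tendsto_nhds]
    intro ε hε
    have hval : dunklQuotient α f x₀ = fderiv ℝ f x₀ v := by rw [dunklQuotient, if_pos h₀]
    filter_upwards [hlo.def (show 0 < ε / (2 * ‖v‖) by positivity),
      Metric.tendsto_nhds.1 (hcont.tendsto x₀) ε hε] with x h1 h2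
    rw [hval]
    by_cases hx : inner ℝ α x = 0
    · rwa [dunklQuotient, if_pos hx]
    · have hsub : x - rootReflection α x = inner ℝ α x • v := by
        rw [rootReflection_apply_eq_sub, sub_sub_cancel]
      simp only [Function.comp_apply, hsub, map_smul, smul_eq_mul, norm_smul] at h1
      have hxpos : 0 < ‖inner ℝ α x‖ := norm_pos_iff.2 hx
      rw [dunklQuotient_of_inner_ne_zero hx, dist_eq_norm, div_sub' hx, norm_div,
        div_lt_iff₀ hxpos]
      refine h1.trans_lt ?_
      rw [show ε / (2 * ‖v‖) * (‖inner ℝ α x‖ * ‖v‖) = ε / 2 * ‖inner ℝ α x‖ by field_simp]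
      gcongr
      linarith
  · have hev : dunklQuotient α f =ᶠ[nhds x₀]
        fun x => (f x - f (rootReflection α x)) / inner ℝ α x := by
      filter_upwards [hin.continuousAt.eventually_ne h₀] with x hx
      exact dunklQuotient_of_inner_ne_zero hx f
    refine ContinuousAt.congr ?_ hev.symm
    refine ContinuousAt.div ?_ hin.continuousAt h₀
    exact (hf.continuous.sub (hf.continuous.comp (rootReflection α).continuous)).continuousAt

variable {Φ : EuclideanRootSystem V} (S : Φ.SimpleSystem) (k : Φ.Multiplicity)

theorem continuous_dunklOp (ξ : V) {f : V → ℝ} (hf : ContDiff ℝ 1 f) :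
    Continuous (dunklOp S k ξ f) := by
  have h1 : Continuous fun x => fderiv ℝ f x ξ :=
    (hf.continuous_fderiv one_ne_zero).clm_apply continuous_const
  refine h1.add (continuous_finsetSum _ fun α hα => continuous_const.mul ?_)
  exact continuous_dunklQuotient (Φ.ne_zero α (S.mem_roots_of_mem_positiveRoots hα)) hf

/-- The summand is even in `α`: the signs of `⟪α, ξ⟫` and of the quotient cancel. Hence `R₊` may be
replaced by its image under `w`. -/
theorem sum_dunklQuotient_comp {w : V ≃ₗᵢ[ℝ] V} (hw : w ∈ Φ.weylGroup) (ξ : V) (f : V → ℝ)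
    (x : V) :
    ∑ α ∈ S.positiveRoots, k.toFun α * inner ℝ α ξ * dunklQuotient α (fun z => f (w z)) x =
      ∑ α ∈ S.positiveRoots, k.toFun α * inner ℝ α (w ξ) * dunklQuotient α f (w x) := by
  rw [← S.sum_positiveRoots_map hw
    (fun α => k.toFun α * inner ℝ α (w ξ) * dunklQuotient α f (w x))]
  · refine Finset.sum_congr rfl fun α hα => ?_
    rw [k.invariant w hw α (S.mem_roots_of_mem_positiveRoots hα), w.inner_map_map,
      dunklQuotient_comp]
  · intro α hα
    rw [k.map_neg hα, dunklQuotient_neg, inner_neg_left]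
    ring

theorem dunklOp_self (f : V → ℝ) (x : V) :
    dunklOp S k x f x = fderiv ℝ f x x +
      ∑ α ∈ S.positiveRoots, k.toFun α * (f x - f (rootReflection α x)) := by
  rw [dunklOp]
  congr 1
  refine Finset.sum_congr rfl fun α _ => ?_
  rw [mul_assoc, inner_mul_dunklQuotient]

theorem dunklQuotient_sum_mul {ι : Type*} (I : Finset ι) (c : ι → ℝ) (F : ι → V → ℝ)
    (hF : ∀ i ∈ I, Differentiable ℝ (F i)) (α x : V) :
    dunklQuotient α (fun z => ∑ i ∈ I, c i * F i z) x =
      ∑ i ∈ I, c i * dunklQuotient α (F i) x := by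
  have hd : fderiv ℝ (fun z => ∑ i ∈ I, c i * F i z) x = ∑ i ∈ I, c i • fderiv ℝ (F i) x := by
    rw [fderiv_fun_sum fun i hi => ((hF i hi) x).const_mul (c i)]
    exact Finset.sum_congr rfl fun i hi => fderiv_const_mul ((hF i hi) x) (c i)
  by_cases h : inner ℝ α x = 0
  · simp only [dunklQuotient, if_pos h, hd, sum_apply, smul_apply, smul_eq_mul]
  · simp only [dunklQuotient, if_neg h, ← Finset.sum_sub_distrib, Finset.sum_div, mul_sub, sub_div,
      mul_div_assoc]

theorem dunklOp_sum_mul {ι : Type*} (I : Finset ι) (c : ι → ℝ) (F : ι → V → ℝ)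
    (hF : ∀ i ∈ I, Differentiable ℝ (F i)) (ξ x : V) :
    dunklOp S k ξ (fun z => ∑ i ∈ I, c i * F i z) x = ∑ i ∈ I, c i * dunklOp S k ξ (F i) x := by
  have hd : fderiv ℝ (fun z => ∑ i ∈ I, c i * F i z) x = ∑ i ∈ I, c i • fderiv ℝ (F i) x := by
    rw [fderiv_fun_sum fun i hi => ((hF i hi) x).const_mul (c i)]
    exact Finset.sum_congr rfl fun i hi => fderiv_const_mul ((hF i hi) x) (c i)
  simp only [dunklOp, dunklQuotient_sum_mul I c F hF, hd, sum_apply, smul_apply, smul_eq_mul,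
    mul_add, Finset.sum_add_distrib, Finset.mul_sum]
  congr 1
  rw [Finset.sum_comm]
  exact Finset.sum_congr rfl fun _ _ => Finset.sum_congr rfl fun _ _ => by ring

end DunklOperator

/-! ### The radial equation and the defect of its solutions. -/

section RadialEquation

variable {V : Type*} [NormedAddCommGroup V] [InnerProductSpace ℝ V]
  {Φ : EuclideanRootSystem V} (S : Φ.SimpleSystem) (k : Φ.Multiplicity)

theorem EuclideanRootSystem.SimpleSystem.multiplicity_nonneg {α : V} (hα : α ∈ S.positiveRoots) :
    0 ≤ k.toFun α :=
  k.nonneg α (S.mem_roots_of_mem_positiveRoots hα)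

theorem eq_zero_of_singular_weylGroup_system (a : (V ≃ₗᵢ[ℝ] V) → ℝ)
    (H d : (V ≃ₗᵢ[ℝ] V) → ℝ → ℝ)
    (hcont : ∀ w ∈ Φ.weylGroup, ContinuousOn (H w) (Set.Icc 0 1))
    (hzero : ∀ w ∈ Φ.weylGroup, H w 0 = 0)
    (hderiv : ∀ w ∈ Φ.weylGroup, ∀ t ∈ Set.Ioo (0 : ℝ) 1, HasDerivAt (H w) (d w t) t)
    (heq : ∀ w ∈ Φ.weylGroup, ∀ t ∈ Set.Ioo (0 : ℝ) 1,
      t * d w t = ∑ α ∈ S.positiveRoots, k.toFun α * (H (rootReflection α * w) t - H w t) +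
        t * (a w * H w t)) : H 1 1 = 0 := by
  let e : {α // α ∈ S.positiveRoots} → Equiv.Perm Φ.weylGroup := fun α =>
    Equiv.mulLeft ⟨rootReflection (α : V),
      Φ.rootReflection_mem_weylGroup (S.mem_roots_of_mem_positiveRoots α.2)⟩
  refine eq_zero_of_singular_exchange_system (W := Φ.weylGroup) S.positiveRoots.attach
    (fun α => k.toFun α) (fun α _ => S.multiplicity_nonneg k α.2) e (fun w => a w)
    (fun w => H w) (fun w => d w) (fun w => hcont w w.2) (fun w => hzero w w.2)
    (fun w => hderiv w w.2) (fun w t ht => ?_) 1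
  rw [heq w w.2 t ht, ← Finset.sum_attach S.positiveRoots]
  rfl

/-- The contraction of the joint eigenvalue problem `T_ξ f = ⟪ξ, y⟫ f` with `ξ = x`. -/
def IsRadialSolution (y : V) (f : V → ℝ) : Prop :=
  ∀ x, fderiv ℝ f x x + ∑ α ∈ S.positiveRoots, k.toFun α * (f x - f (rootReflection α x)) =
    inner ℝ x y * f x

variable {S k}

theorem hasDerivAt_comp_smul {f : V → ℝ} (hf : Differentiable ℝ f) (x : V) (t : ℝ) :
    HasDerivAt (fun s : ℝ => f (s • x)) (fderiv ℝ f (t • x) x) t := by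
  have h : HasDerivAt (fun s : ℝ => s • x) x t := by
    simpa using (hasDerivAt_id t).smul_const x
  exact (hf (t • x)).hasFDerivAt.comp_hasDerivAt t h

/-- The system is formed by the functions `t ↦ h (t • w x)`, one for each `w`; a reflection `σ_α`
exchanges the entries `w` and `σ_α w`. -/
theorem IsRadialSolution.eq_zero {y : V} {h : V → ℝ} (hh : IsRadialSolution S k y h)
    (hd : Differentiable ℝ h) (h0 : h 0 = 0) (x : V) : h x = 0 := by
  have key := eq_zero_of_singular_weylGroup_system S k (fun w => inner ℝ (w x) y)
    (fun w t => h (t • w x)) (fun w t => fderiv ℝ h (t • w x) (w x))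
    (fun w _ => (hd.continuous.comp (by fun_prop)).continuousOn)
    (fun w _ => by simpa using h0)
    (fun w _ t _ => hasDerivAt_comp_smul hd (w x) t)
    (fun w _ t _ => by
      have hz := hh (t • w x)
      rw [map_smul, smul_eq_mul, real_inner_smul_left] at hz
      have hs : ∑ α ∈ S.positiveRoots,
          k.toFun α * (h (t • (rootReflection α * w) x) - h (t • w x)) =
          -∑ α ∈ S.positiveRoots,
            k.toFun α * (h (t • w x) - h (rootReflection α (t • w x))) := by
        rw [← Finset.sum_neg_distrib]
        refine Finset.sum_congr rfl fun α _ => ?_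
        rw [map_smul, LinearIsometryEquiv.coe_mul, Function.comp_apply]
        ring
      rw [hs]
      linear_combination hz)
  simpa using key

theorem IsRadialSolution.sub {y : V} {f g : V → ℝ} (hf : IsRadialSolution S k y f)
    (hg : IsRadialSolution S k y g) (hfd : Differentiable ℝ f) (hgd : Differentiable ℝ g) :
    IsRadialSolution S k y (fun x => f x - g x) := fun x => by
  have hs : ∑ α ∈ S.positiveRoots,
      k.toFun α * (f x - g x - (f (rootReflection α x) - g (rootReflection α x))) =
      ∑ α ∈ S.positiveRoots, k.toFun α * (f x - f (rootReflection α x)) -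
        ∑ α ∈ S.positiveRoots, k.toFun α * (g x - g (rootReflection α x)) := by
    rw [← Finset.sum_sub_distrib]
    exact Finset.sum_congr rfl fun _ _ => by ring
  rw [fderiv_fun_sub (hfd x) (hgd x), hs, sub_apply]
  linear_combination hf x - hg x

theorem IsDunklEigenfunction.differentiable {y : V} {f : V → ℝ}
    (hf : IsDunklEigenfunction S k y f) : Differentiable ℝ f :=
  fun x => (hf.analytic x trivial).differentiableAt

theorem IsDunklEigenfunction.isRadialSolution {y : V} {f : V → ℝ}
    (hf : IsDunklEigenfunction S k y f) : IsRadialSolution S k y f := fun x => by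
  rw [← dunklOp_self, hf.eigen]

theorem IsDunklEigenfunction.unique {y : V} {f g : V → ℝ} (hf : IsDunklEigenfunction S k y f)
    (hg : IsDunklEigenfunction S k y g) : f = g := by
  funext x
  exact sub_eq_zero.1 ((hf.isRadialSolution.sub hg.isRadialSolution hf.differentiable
    hg.differentiable).eq_zero (hf.differentiable.sub hg.differentiable)
    (by rw [hf.map_zero, hg.map_zero, sub_self]) x)

/-- The radial equation differentiated in direction `ξ`. Symmetry of the second derivative turns the
result into a radial derivative of `∂_ξ f`, as needed for the defect. -/
theorem IsRadialSolution.fderiv_fderiv {y : V} {f : V → ℝ} (hf : IsRadialSolution S k y f)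
    (hf2 : ContDiff ℝ 2 f) (ξ z : V) :
    fderiv ℝ (fderiv ℝ f) z z ξ + fderiv ℝ f z ξ +
      ∑ α ∈ S.positiveRoots, k.toFun α *
        (fderiv ℝ f z ξ - fderiv ℝ f (rootReflection α z) (rootReflection α ξ)) =
      inner ℝ ξ y * f z + inner ℝ z y * fderiv ℝ f z ξ := by
  have hd : Differentiable ℝ f := hf2.differentiable two_ne_zero
  have hd' : Differentiable ℝ (fderiv ℝ f) :=
    (hf2.fderiv_right (m := 1) (by norm_num)).differentiable one_ne_zero
  have hsymm : fderiv ℝ (fderiv ℝ f) z z ξ = fderiv ℝ (fderiv ℝ f) z ξ z :=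
    (hf2.contDiffAt.isSymmSndFDerivAt (by simp)).eq z ξ
  have hline : HasDerivAt (fun s : ℝ => z + s • ξ) ξ 0 := by
    simpa using ((hasDerivAt_id (0 : ℝ)).smul_const ξ).const_add z
  have hz : z + (0 : ℝ) • ξ = z := by simp
  have h1 : HasDerivAt (fun s : ℝ => f (z + s • ξ)) (fderiv ℝ f z ξ) 0 := by
    refine HasFDerivAt.comp_hasDerivAt 0 ?_ hline
    rw [hz]
    exact (hd z).hasFDerivAt
  have h2 : HasDerivAt (fun s : ℝ => fderiv ℝ f (z + s • ξ) (z + s • ξ))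
      (fderiv ℝ (fderiv ℝ f) z ξ z + fderiv ℝ f z ξ) 0 := by
    have h : HasDerivAt (fun s : ℝ => fderiv ℝ f (z + s • ξ)) (fderiv ℝ (fderiv ℝ f) z ξ) 0 := by
      refine HasFDerivAt.comp_hasDerivAt 0 ?_ hline
      rw [hz]
      exact (hd' z).hasFDerivAt
    simpa using h.clm_apply hline
  have h3 : ∀ α, HasDerivAt (fun s : ℝ => f (rootReflection α (z + s • ξ)))
      (fderiv ℝ f (rootReflection α z) (rootReflection α ξ)) 0 := fun α => by
    have h : HasDerivAt (fun s : ℝ => rootReflection α (z + s • ξ)) (rootReflection α ξ) 0 := by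
      simpa using ((hasDerivAt_id (0 : ℝ)).smul_const (rootReflection α ξ)).const_add
        (rootReflection α z)
    refine HasFDerivAt.comp_hasDerivAt 0 ?_ h
    rw [hz]
    exact (hd _).hasFDerivAt
  have h4 : HasDerivAt (fun s : ℝ => inner ℝ (z + s • ξ) y) (inner ℝ ξ y) 0 := by
    simpa using hline.inner ℝ (hasDerivAt_const (0 : ℝ) y)
  have hl := h2.add (HasDerivAt.fun_sum (u := S.positiveRoots)
    fun α _ => (h1.sub (h3 α)).const_mul (k.toFun α))
  have hr := h4.mul h1
  have he := hl.unique (hr.congr_of_eventuallyEq (Filter.Eventually.of_forall fun s =>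
    hf (z + s • ξ)))
  rw [hz] at he
  rw [hsymm]
  exact he

theorem hasDerivAt_dunklOp_comp_smul {f : V → ℝ} (hf2 : ContDiff ℝ 2 f) (ξ : V) {z : V}
    (hz : ∀ α ∈ S.positiveRoots, inner ℝ α z ≠ 0) :
    HasDerivAt (fun s : ℝ => dunklOp S k ξ f (s • z))
      (fderiv ℝ (fderiv ℝ f) z z ξ + ∑ α ∈ S.positiveRoots, k.toFun α * inner ℝ α ξ *
        ((fderiv ℝ f z z - fderiv ℝ f (rootReflection α z) (rootReflection α z)) / inner ℝ α z -
          dunklQuotient α f z)) 1 := by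
  have hd : Differentiable ℝ f := hf2.differentiable two_ne_zero
  have hd' : Differentiable ℝ (fderiv ℝ f) :=
    (hf2.fderiv_right (m := 1) (by norm_num)).differentiable one_ne_zero
  have hline : HasDerivAt (fun s : ℝ => s • z) z 1 := by
    simpa using (hasDerivAt_id (1 : ℝ)).smul_const z
  have h1 : HasDerivAt (fun s : ℝ => fderiv ℝ f (s • z) ξ) (fderiv ℝ (fderiv ℝ f) z z ξ) 1 := by
    have h : HasDerivAt (fun s : ℝ => fderiv ℝ f (s • z)) (fderiv ℝ (fderiv ℝ f) z z) 1 := by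
      refine HasFDerivAt.comp_hasDerivAt 1 ?_ hline
      rw [one_smul]
      exact (hd' z).hasFDerivAt
    simpa using h.clm_apply (hasDerivAt_const (1 : ℝ) ξ)
  refine h1.add (HasDerivAt.fun_sum fun α hα => HasDerivAt.const_mul _ ?_)
  have hne := hz α hα
  have hev : (fun s : ℝ => dunklQuotient α f (s • z)) =ᶠ[nhds 1]
      fun s => (f (s • z) - f (s • rootReflection α z)) / (s * inner ℝ α z) := by
    filter_upwards [continuousAt_id.eventually_ne (one_ne_zero (α := ℝ))] with s hs
    rw [dunklQuotient_of_inner_ne_zero (by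
      rw [real_inner_smul_right]
      exact mul_ne_zero hs hne), real_inner_smul_right, map_smul]
  refine HasDerivAt.congr_of_eventuallyEq ?_ hev
  have hn := (hasDerivAt_comp_smul hd z 1).sub (hasDerivAt_comp_smul hd (rootReflection α z) 1)
  have hm : HasDerivAt (fun s : ℝ => s * inner ℝ α z) (inner ℝ α z) 1 := by
    simpa using (hasDerivAt_id (1 : ℝ)).mul_const (inner ℝ α z)
  refine (hn.div hm (by simpa using hne)).congr_deriv ?_
  rw [dunklQuotient_of_inner_ne_zero hne]
  simp only [one_smul, one_mul, Pi.sub_apply]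
  field_simp

/-- The difference-quotient part of `T_ξ` applied to the radial equation: its instances at `z` and
`σ_α z` are subtracted and divided by `⟪α, z⟫`. Equivariance rewrites the double sum through `f ∘
σ_β`, after which the identity holds term by term in `α`. -/
theorem IsRadialSolution.sum_euler_quotient {y : V} {f : V → ℝ} (hf : IsRadialSolution S k y f)
    (ξ : V) {z : V} (hz : ∀ α ∈ S.positiveRoots, inner ℝ α z ≠ 0) :
    ∑ α ∈ S.positiveRoots, k.toFun α * inner ℝ α ξ *
        ((fderiv ℝ f z z - fderiv ℝ f (rootReflection α z) (rootReflection α z)) / inner ℝ α z) =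
      inner ℝ z y * ∑ α ∈ S.positiveRoots, k.toFun α * inner ℝ α ξ * dunklQuotient α f z +
      ∑ α ∈ S.positiveRoots, k.toFun α * (inner ℝ (ξ - rootReflection α ξ) y *
        f (rootReflection α z)) -
      ∑ β ∈ S.positiveRoots, k.toFun β *
        (∑ α ∈ S.positiveRoots, k.toFun α * inner ℝ α ξ * dunklQuotient α f z -
          ∑ α ∈ S.positiveRoots, k.toFun α * inner ℝ α (rootReflection β ξ) *
            dunklQuotient α f (rootReflection β z)) := by
  have hcomp : ∀ β ∈ S.positiveRoots, ∑ α ∈ S.positiveRoots,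
      k.toFun α * inner ℝ α (rootReflection β ξ) * dunklQuotient α f (rootReflection β z) =
      ∑ α ∈ S.positiveRoots, k.toFun α * inner ℝ α ξ *
        dunklQuotient α (fun x => f (rootReflection β x)) z := fun β hβ =>
    (sum_dunklQuotient_comp S k
      (Φ.rootReflection_mem_weylGroup (S.mem_roots_of_mem_positiveRoots hβ)) ξ f z).symm
  have hlast : ∑ β ∈ S.positiveRoots, k.toFun β *
        (∑ α ∈ S.positiveRoots, k.toFun α * inner ℝ α ξ * dunklQuotient α f z -
          ∑ α ∈ S.positiveRoots, k.toFun α * inner ℝ α (rootReflection β ξ) *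
            dunklQuotient α f (rootReflection β z)) =
      ∑ α ∈ S.positiveRoots, k.toFun α * inner ℝ α ξ * ∑ β ∈ S.positiveRoots, k.toFun β *
        (dunklQuotient α f z - dunklQuotient α (fun x => f (rootReflection β x)) z) := by
    rw [Finset.sum_congr rfl fun β hβ => by rw [hcomp β hβ]]
    simp only [← Finset.sum_sub_distrib, Finset.mul_sum]
    rw [Finset.sum_comm]
    exact Finset.sum_congr rfl fun _ _ => Finset.sum_congr rfl fun _ _ => by ring
  rw [hlast, Finset.mul_sum, ← Finset.sum_add_distrib, ← Finset.sum_sub_distrib]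
  refine Finset.sum_congr rfl fun α hα => ?_
  have hne := hz α hα
  have hz1 : fderiv ℝ f z z = inner ℝ z y * f z -
      ∑ β ∈ S.positiveRoots, k.toFun β * (f z - f (rootReflection β z)) :=
    eq_sub_of_add_eq (hf z)
  have hz2 : fderiv ℝ f (rootReflection α z) (rootReflection α z) =
      inner ℝ (rootReflection α z) y * f (rootReflection α z) -
      ∑ β ∈ S.positiveRoots, k.toFun β *
        (f (rootReflection α z) - f (rootReflection β (rootReflection α z))) :=
    eq_sub_of_add_eq (hf (rootReflection α z))
  have hsum : ∑ β ∈ S.positiveRoots, k.toFun β *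
        (dunklQuotient α f z - dunklQuotient α (fun x => f (rootReflection β x)) z) =
      (∑ β ∈ S.positiveRoots, k.toFun β * (f z - f (rootReflection β z)) -
        ∑ β ∈ S.positiveRoots, k.toFun β *
        (f (rootReflection α z) - f (rootReflection β (rootReflection α z)))) / inner ℝ α z := by
    rw [← Finset.sum_sub_distrib, Finset.sum_div]
    refine Finset.sum_congr rfl fun β _ => ?_
    rw [dunklQuotient_of_inner_ne_zero hne, dunklQuotient_of_inner_ne_zero hne]
    field_simp
    ring
  have hv1 : inner ℝ (rootReflection α z) y =
      inner ℝ z y - inner ℝ α z * inner ℝ ((2 / inner ℝ α α : ℝ) • α) y := by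
    rw [rootReflection_apply_eq_sub, inner_sub_left, real_inner_smul_left]
  have hv2 : inner ℝ (ξ - rootReflection α ξ) y =
      inner ℝ α ξ * inner ℝ ((2 / inner ℝ α α : ℝ) • α) y := by
    rw [rootReflection_apply_eq_sub, sub_sub_cancel, real_inner_smul_left]
  rw [hz1, hz2, hsum, hv1, hv2, dunklQuotient_of_inner_ne_zero hne]
  field_simp
  ring

/-- Along rays through regular points, the defect `T_ξ f - ⟪ξ, y⟫ f` of a radial solution obeys
a linear system over the Weyl group orbit. -/
theorem IsRadialSolution.hasDerivAt_defect {y : V} {f : V → ℝ} (hf : IsRadialSolution S k y f)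
    (hf2 : ContDiff ℝ 2 f) (ξ : V) {z : V} (hz : ∀ α ∈ S.positiveRoots, inner ℝ α z ≠ 0) :
    HasDerivAt (fun s : ℝ => dunklOp S k ξ f (s • z) - inner ℝ ξ y * f (s • z))
      ((inner ℝ z y - 1) * (dunklOp S k ξ f z - inner ℝ ξ y * f z) +
        ∑ α ∈ S.positiveRoots, k.toFun α *
          ((dunklOp S k (rootReflection α ξ) f (rootReflection α z) -
            inner ℝ (rootReflection α ξ) y * f (rootReflection α z)) -
          (dunklOp S k ξ f z - inner ℝ ξ y * f z))) 1 := by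
  have h1 := hasDerivAt_dunklOp_comp_smul (S := S) (k := k) hf2 ξ hz
  have h2 := (hasDerivAt_comp_smul (hf2.differentiable two_ne_zero) z 1).const_mul (inner ℝ ξ y)
  refine (h1.sub h2).congr_deriv ?_
  have e1 := hf.fderiv_fderiv hf2 ξ z
  have e2 := hf.sum_euler_quotient ξ hz
  have e3 := hf z
  have hsplit : ∑ α ∈ S.positiveRoots, k.toFun α *
      ((dunklOp S k (rootReflection α ξ) f (rootReflection α z) -
        inner ℝ (rootReflection α ξ) y * f (rootReflection α z)) -
      (dunklOp S k ξ f z - inner ℝ ξ y * f z)) =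
      -∑ α ∈ S.positiveRoots, k.toFun α *
        (fderiv ℝ f z ξ - fderiv ℝ f (rootReflection α z) (rootReflection α ξ)) -
      ∑ β ∈ S.positiveRoots, k.toFun β *
        (∑ α ∈ S.positiveRoots, k.toFun α * inner ℝ α ξ * dunklQuotient α f z -
          ∑ α ∈ S.positiveRoots, k.toFun α * inner ℝ α (rootReflection β ξ) *
            dunklQuotient α f (rootReflection β z)) +
      ∑ α ∈ S.positiveRoots, k.toFun α * (inner ℝ (ξ - rootReflection α ξ) y *
        f (rootReflection α z)) +
      inner ℝ ξ y * ∑ α ∈ S.positiveRoots, k.toFun α * (f z - f (rootReflection α z)) := by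
    rw [← Finset.sum_neg_distrib, ← Finset.sum_sub_distrib, ← Finset.sum_add_distrib,
      Finset.mul_sum, ← Finset.sum_add_distrib]
    refine Finset.sum_congr rfl fun α _ => ?_
    rw [inner_sub_left]
    simp only [dunklOp]
    ring
  have hX : ∑ α ∈ S.positiveRoots, k.toFun α * inner ℝ α ξ *
        ((fderiv ℝ f z z - fderiv ℝ f (rootReflection α z) (rootReflection α z)) / inner ℝ α z -
          dunklQuotient α f z) =
      ∑ α ∈ S.positiveRoots, k.toFun α * inner ℝ α ξ *
        ((fderiv ℝ f z z - fderiv ℝ f (rootReflection α z) (rootReflection α z)) / inner ℝ α z) -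
      ∑ α ∈ S.positiveRoots, k.toFun α * inner ℝ α ξ * dunklQuotient α f z := by
    rw [← Finset.sum_sub_distrib]
    exact Finset.sum_congr rfl fun _ _ => mul_sub _ _ _
  have hT : dunklOp S k ξ f z = fderiv ℝ f z ξ +
      ∑ α ∈ S.positiveRoots, k.toFun α * inner ℝ α ξ * dunklQuotient α f z := rfl
  rw [hsplit, hX, one_smul, hT]
  -- `e1 + e2` amounts to `T_ξ` applied to the radial equation; subtracting `⟪ξ, y⟫` times that
  -- equation leaves the defects.
  linear_combination e1 + e2 - inner ℝ ξ y * e3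

end RadialEquation

/-! ### Construction of the Dunkl kernel and the operator identities. -/

section DunklKernel

variable {V : Type*} [NormedAddCommGroup V] [InnerProductSpace ℝ V]

theorem dense_inner_ne_zero {α : V} (hα : α ≠ 0) : Dense {x : V | inner ℝ α x ≠ 0} := by
  have h : interior ((ℝ ∙ α)ᗮ : Set V) = ∅ := by
    by_contra hne
    have htop := Submodule.eq_top_of_nonempty_interior' _ (Set.nonempty_iff_ne_empty.2 hne)
    have hmem : α ∈ (ℝ ∙ α)ᗮ := htop ▸ Submodule.mem_top
    exact hα (inner_self_eq_zero.1 (Submodule.mem_orthogonal_singleton_iff_inner_right.1 hmem))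
  have hd := interior_eq_empty_iff_dense_compl.1 h
  convert hd using 1
  ext x
  simp [Submodule.mem_orthogonal_singleton_iff_inner_right]

variable {Φ : EuclideanRootSystem V} {S : Φ.SimpleSystem} {k : Φ.Multiplicity}

theorem EuclideanRootSystem.dense_regular [CompleteSpace V] (Φ : EuclideanRootSystem V) :
    Dense {x : V | ∀ α ∈ Φ.roots, inner ℝ α x ≠ 0} := by
  have h := dense_biInter_of_isOpen (S := (Φ.roots : Set V))
    (f := fun α => {x : V | inner ℝ α x ≠ 0})
    (fun α _ => isOpen_ne_fun (by fun_prop) continuous_const) Φ.roots.countable_toSet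
    (fun α hα => dense_inner_ne_zero (Φ.ne_zero α hα))
  convert h using 1
  ext x
  simp

theorem IsRadialSolution.dunklOp_eq_of_regular {y : V} {f : V → ℝ}
    (hf : IsRadialSolution S k y f) (hf2 : ContDiff ℝ 2 f) (ξ : V) {x : V}
    (hx : ∀ α ∈ Φ.roots, inner ℝ α x ≠ 0) :
    dunklOp S k ξ f x = inner ℝ ξ y * f x := by
  let g : V → V → ℝ := fun η z => dunklOp S k η f z - inner ℝ η y * f z
  have hgc : ∀ η, Continuous (g η) := fun η =>
    (continuous_dunklOp S k η (hf2.of_le (by norm_num))).sub (continuous_const.mul hf2.continuous)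
  have hreg : ∀ w ∈ Φ.weylGroup, ∀ t : ℝ, t ≠ 0 → ∀ α ∈ S.positiveRoots,
      inner ℝ α (t • w x) ≠ 0 := fun w hw t ht α hα => by
    rw [real_inner_smul_right, ← w.apply_symm_apply α, w.inner_map_map]
    exact mul_ne_zero ht (hx _ (Φ.map_mem_roots (inv_mem hw) (S.mem_roots_of_mem_positiveRoots hα)))
  -- The extra factor `t` absorbs the `-1` in the defect equation and forces the initial value `0`.
  have key := eq_zero_of_singular_weylGroup_system S k (fun w => inner ℝ (w x) y)
    (fun w t => t * g (w ξ) (t • w x))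
    (fun w t => inner ℝ (t • w x) y * g (w ξ) (t • w x) +
      ∑ α ∈ S.positiveRoots, k.toFun α * (g (rootReflection α (w ξ)) (rootReflection α (t • w x)) -
        g (w ξ) (t • w x)))
    (fun w _ => (continuous_id.mul ((hgc _).comp (by fun_prop))).continuousOn)
    (fun w _ => zero_mul _)
    (fun w hw t ht => by
      have ht0 : t ≠ 0 := ht.1.ne'
      have h1 := hf.hasDerivAt_defect hf2 (w ξ) (hreg w hw t ht0)
      -- The defect derivative is taken at scale `1` from the base point `t • w x`; the substitution
      -- `s / t` moves it to parameter `t`.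
      have h2 : HasDerivAt (fun s : ℝ => s / t) (1 / t) t := (hasDerivAt_id t).div_const t
      have h3 := HasDerivAt.comp t (by rwa [div_self ht0]) h2
      have h4 := (hasDerivAt_id t).mul h3
      refine (h4.congr_of_eventuallyEq (Filter.Eventually.of_forall fun s => ?_)).congr_deriv ?_
      · simp only [g, id, Pi.mul_apply, Function.comp_apply, smul_smul, div_mul_cancel₀ s ht0]
      · simp only [g, id, Function.comp_apply, div_self ht0, one_smul]
        field_simp
        ring)
    (fun w _ t _ => by
      simp only [LinearIsometryEquiv.coe_mul, Function.comp_apply, map_smul, mul_add,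
        Finset.mul_sum, real_inner_smul_left]
      rw [add_comm]
      congr 1
      · exact Finset.sum_congr rfl fun _ _ => by ring
      · ring)
  have key' : g ξ x = 0 := by simpa using key
  exact sub_eq_zero.1 key'

theorem IsRadialSolution.dunklOp_eq [CompleteSpace V] {y : V} {f : V → ℝ}
    (hf : IsRadialSolution S k y f) (hf2 : ContDiff ℝ 2 f) (ξ x : V) :
    dunklOp S k ξ f x = inner ℝ ξ y * f x := by
  have h := Continuous.ext_on Φ.dense_regular
    (continuous_dunklOp S k ξ (hf2.of_le (by norm_num)))
    (continuous_const.mul hf2.continuous)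
    fun z hz => hf.dunklOp_eq_of_regular hf2 ξ hz
  exact congrFun h x

theorem exists_dunklKernel [CompleteSpace V] (S : Φ.SimpleSystem) (k : Φ.Multiplicity) :
    ∃ K : V → V → ℝ, ContDiff ℝ ∞ (fun p : V × V => K p.1 p.2) ∧
      (∀ y, IsDunklEigenfunction S k y fun x => K x y) ∧
      ∀ (t : ℝ) (x y : V), K (t • x) y = K x (t • y) := by
  -- Right multiplication by `σ_α`, since the coordinate `⟪y, w (σ_α x)⟫` of `σ_α x` is the
  -- coordinate of `x` at `w σ_α`.
  let τ : {α // α ∈ S.positiveRoots} → (Φ.weylGroup → ℝ) →L[ℝ] (Φ.weylGroup → ℝ) := fun α =>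
    ContinuousLinearMap.pi fun w => ContinuousLinearMap.proj (w * ⟨rootReflection (α : V),
      Φ.rootReflection_mem_weylGroup (S.mem_roots_of_mem_positiveRoots α.2)⟩)
  have hτ : ∀ α ∈ S.positiveRoots.attach, ‖τ α‖ ≤ 1 := fun α _ => by
    refine ContinuousLinearMap.opNorm_le_bound _ zero_le_one fun z => ?_
    rw [one_mul]
    exact (pi_norm_le_iff_of_nonneg (norm_nonneg z)).2 fun w => norm_le_pi_norm z _
  obtain ⟨F, hFa, hF0, hF⟩ := exists_entire_solution S.positiveRoots.attach
    (fun α => k.toFun α) (fun α _ => S.multiplicity_nonneg k α.2) τ hτ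
    (ContinuousLinearMap.proj (1 : Φ.weylGroup))
  have hFd : Differentiable ℝ F := fun z => (hFa z trivial).differentiableAt
  have hFc : ∀ n : WithTop ℕ∞, ContDiff ℝ n F := fun n =>
    contDiffOn_univ.1 (hFa.contDiffOn uniqueDiffOn_univ)
  let L : V → V →L[ℝ] (Φ.weylGroup → ℝ) := fun y => ContinuousLinearMap.pi fun w =>
    (innerSL ℝ y).comp ((w : V ≃ₗᵢ[ℝ] V).toContinuousLinearEquiv : V →L[ℝ] V)
  have hL : ∀ y x (w : Φ.weylGroup), L y x w = inner ℝ y ((w : V ≃ₗᵢ[ℝ] V) x) :=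
    fun _ _ _ => rfl
  refine ⟨fun x y => F (L y x), ?_, fun y => ?_, fun t x y => ?_⟩
  · refine (hFc ∞).comp (contDiff_pi.2 fun w => ?_)
    simp only [hL]
    exact contDiff_snd.inner ℝ ((w : V ≃ₗᵢ[ℝ] V).contDiff.comp contDiff_fst)
  · have hc : ∀ n : WithTop ℕ∞, ContDiff ℝ n fun x => F (L y x) := fun n =>
      (hFc n).comp (L y).contDiff
    have hrad : IsRadialSolution S k y fun x => F (L y x) := fun x => by
      have hd : fderiv ℝ (fun x => F (L y x)) x x = fderiv ℝ F (L y x) (L y x) := by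
        have h := ((hFd (L y x)).hasFDerivAt.comp x (L y).hasFDerivAt).fderiv
        exact DFunLike.congr_fun h x
      rw [hd, ← Finset.sum_attach S.positiveRoots, real_inner_comm]
      exact hF (L y x)
    exact ⟨fun x _ => (hFa (L y x) trivial).comp ((L y).analyticAt x),
      fun ξ x => hrad.dunklOp_eq (hc 2) ξ x, by simp [hF0]⟩
  · have h : L y (t • x) = L (t • y) x := by
      funext w
      rw [hL, hL, map_smul, real_inner_smul_left, real_inner_smul_right]
    simp only [h]

theorem eulerOp_eq_fderiv {m : ℕ} (b : OrthonormalBasis (Fin m) ℝ V) (f : V → ℝ) (x : V) :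
    eulerOp b f x = fderiv ℝ f x x := by
  conv_rhs => rw [← b.sum_repr x]
  rw [map_sum, b.sum_repr]
  simp only [map_smul, smul_eq_mul]
  rfl

theorem dunklLaplacian_sum_mul {m : ℕ} (b : OrthonormalBasis (Fin m) ℝ V) {ι : Type*}
    (I : Finset ι) (c : ι → ℝ) (F : ι → V → ℝ) (y : ι → V)
    (hF : ∀ i ∈ I, IsDunklEigenfunction S k (y i) (F i)) (x : V) :
    dunklLaplacian b S k (fun z => ∑ i ∈ I, c i * F i z) x =
      ∑ i ∈ I, ‖y i‖ ^ 2 * (c i * F i x) := by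
  have hd : ∀ i ∈ I, Differentiable ℝ (F i) := fun i hi => (hF i hi).differentiable
  -- Stated for all coefficients, because the second application of `T_ξ` meets the new ones `c i *
  -- ⟪ξ, y i⟫`.
  have hstep : ∀ (c : ι → ℝ) (ξ : V), dunklOp S k ξ (fun z => ∑ i ∈ I, c i * F i z) =
      fun z => ∑ i ∈ I, c i * inner ℝ ξ (y i) * F i z := fun c ξ => by
    funext z
    rw [dunklOp_sum_mul S k I c F hd]
    exact Finset.sum_congr rfl fun i hi => by rw [(hF i hi).eigen, mul_assoc]
  simp only [dunklLaplacian, hstep]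
  rw [Finset.sum_comm]
  refine Finset.sum_congr rfl fun i _ => ?_
  rw [← b.sum_sq_inner_right (y i), Finset.sum_mul]
  exact Finset.sum_congr rfl fun _ _ => by ring

/-- Both sides are the derivative at `t = 1` of the common function `B (t • x) y = B x (t • y)`. -/
theorem fderiv_self_eq_of_smul_swap {B : V → V → ℝ} (hB : ∀ (t : ℝ) x y, B (t • x) y = B x (t • y))
    {x y : V} (hx : Differentiable ℝ fun z => B z y) (hy : Differentiable ℝ fun z => B x z) :
    fderiv ℝ (fun z => B z y) x x = fderiv ℝ (fun z => B x z) y y := by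
  have h1 := hasDerivAt_comp_smul hx x 1
  have h2 := hasDerivAt_comp_smul hy y 1
  simp only [hB, one_smul] at h1 h2
  exact h1.unique h2

theorem fderiv_gaussian_mul_self {f : V → ℝ} (hf : Differentiable ℝ f) (y : V) :
    fderiv ℝ (fun z => Real.exp (-‖z‖ ^ 2 / 2) * f z) y y =
      Real.exp (-‖y‖ ^ 2 / 2) * (fderiv ℝ f y y - ‖y‖ ^ 2 * f y) := by
  have hg : Differentiable ℝ fun z : V => Real.exp (-‖z‖ ^ 2 / 2) := by
    simp only [div_eq_mul_inv]
    exact ((differentiable_fun_id.norm_sq ℝ).fun_neg.mul_const _).exp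
  have h1 := hasDerivAt_comp_smul (hg.mul hf) y 1
  have hq : HasDerivAt (fun s : ℝ => -(s ^ 2 * ‖y‖ ^ 2) / 2) (-‖y‖ ^ 2) 1 := by
    refine ((((hasDerivAt_id (1 : ℝ)).fun_pow 2).mul_const (‖y‖ ^ 2)).fun_neg.div_const
      2).congr_deriv ?_
    simp only [Nat.cast_ofNat, id, one_pow, mul_one]
    ring
  have h2 := hq.exp.mul (hasDerivAt_comp_smul hf y 1)
  have h3 := h1.unique (h2.congr_of_eventuallyEq (Filter.Eventually.of_forall fun s => by
    simp only [Pi.mul_apply, norm_smul, mul_pow, Real.norm_eq_abs, sq_abs]))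
  simp only [one_smul, one_pow, one_mul] at h3
  refine h3.trans ?_
  ring

end DunklKernel

theorem theorem1 {V : Type*} [NormedAddCommGroup V] [InnerProductSpace ℝ V] {m : ℕ}
    (b : OrthonormalBasis (Fin m) ℝ V) (Φ : EuclideanRootSystem V) (S : Φ.SimpleSystem)
    (k : Φ.Multiplicity) :
    (∀ y : V, ∃! f : V → ℝ, IsDunklEigenfunction S k y f) ∧
    ContDiff ℝ ∞ (fun p : V × V => generalizedBessel S k p.1 p.2) ∧
    ∀ x y : V,
      dunklJ b S k (fun x' => Real.exp (-‖y‖ ^ 2 / 2) * generalizedBessel S k x' y) x =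
        eulerOp b (fun y' => Real.exp (-‖y'‖ ^ 2 / 2) * generalizedBessel S k x y') y := by
  have hfin : FiniteDimensional ℝ V := b.toBasis.finiteDimensional_of_finite
  have hcomplete : CompleteSpace V := FiniteDimensional.complete ℝ V
  obtain ⟨K, hKc, hKe, hKs⟩ := exists_dunklKernel S k
  -- Uniqueness identifies the function chosen by `Classical.epsilon` with the constructed kernel,
  -- which transfers joint smoothness and scaling.
  have hK : ∀ x y, dunklKernel S k x y = K x y := fun x y =>
    congrFun ((Classical.epsilon_spec (p := IsDunklEigenfunction S k y) ⟨_, hKe y⟩).unique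
      (hKe y)) x
  have hB : ∀ x y, generalizedBessel S k x y =
      ∑ w : Φ.weylGroup, K x ((w : V ≃ₗᵢ[ℝ] V) y) := fun x y => by
    simp only [generalizedBessel, hK]
  have hBc : ContDiff ℝ ∞ (fun p : V × V => generalizedBessel S k p.1 p.2) := by
    simp only [hB]
    exact ContDiff.sum fun w _ => hKc.comp
      (contDiff_fst.prodMk ((w : V ≃ₗᵢ[ℝ] V).contDiff.comp contDiff_snd))
  refine ⟨fun y => ⟨_, hKe y, fun g hg => hg.unique (hKe y)⟩, hBc, fun x y => ?_⟩
  have hBd := hBc.differentiable (by simp)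
  have hdx : Differentiable ℝ fun z => generalizedBessel S k z y :=
    hBd.comp (differentiable_id.prodMk (differentiable_const y))
  have hdy : Differentiable ℝ fun z => generalizedBessel S k x z :=
    hBd.comp ((differentiable_const x).prodMk differentiable_id)
  have hswap := fderiv_self_eq_of_smul_swap (B := generalizedBessel S k)
    (fun t x y => by simp only [hB, hKs, map_smul]) hdx hdy
  have hlap : dunklLaplacian b S k
      (fun x' => Real.exp (-‖y‖ ^ 2 / 2) * generalizedBessel S k x' y) x =
      ‖y‖ ^ 2 * (Real.exp (-‖y‖ ^ 2 / 2) * generalizedBessel S k x y) := by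
    simp only [hB, Finset.mul_sum]
    rw [dunklLaplacian_sum_mul b Finset.univ _ _
      (fun w : Φ.weylGroup => (w : V ≃ₗᵢ[ℝ] V) y) fun w _ => hKe _]
    simp only [LinearIsometryEquiv.norm_map]
  rw [dunklJ, hlap, eulerOp_eq_fderiv, eulerOp_eq_fderiv, fderiv_gaussian_mul_self hdy,
    fderiv_const_mul (hdx x), smul_apply, hswap, smul_eq_mul]
  ring
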